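/- A compact topological graph $E=(E^0,E^1,r_E,s_E)$ consists of compact Hausdorff spaces $E^0,E^1$, a continuous (proper) map $r_E:E^1\to E^0$ and a local homeomorphism $s_E:E^1\to E^0$. Its C*-correspondence $\mathcal X(E)$ over $C(E^0)$ is the space $C(E^1)$ with $(f\cdot x\cdot g)(e)=f(r_E(e))\,x(e)\,g(s_E(e))$ and $\langle x,y\rangle(v)=\sum_{s_E(e)=v}\overline{x(e)}\,y(e)$, which is complete in the norm $\|x\|=\|\langle x,x\rangle\|^{1/2}$. Let $E$ and $F$ be compact topological graphs with covering dimension $\dim E^0\le 1$ that are locally conjugate via a homeomorphism $\tau:E^0\to F^0$, i.e. every $u\in E^0$ has a neighbourhood $U$ and a homeomorphism $\gamma:s_E^{-1}(U)\to s_F^{-1}(\tau U)$ with $s_F\gamma=\tau s_E$ and $r_F\gamma=\tau r_E$ on $s_E^{-1}(U)$. Let $(U_i)_{1\le i\le n}$ be an admissible open cover of $E^0$ with $m$ sheets, i.e. an open cover together with sets $U_{ik}$ ($1\le k\le m$) and maps $\gamma_i$ such that: (C1) for each $i$, the $U_{ik}$ are disjoint open subsets of $E^1$ with $s_E^{-1}(U_i)=\bigcup_{k=1}^m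 U_{ik}$, and $s_E$ maps each $U_{ik}$ homeomorphically onto $U_i$; (C2) $\gamma_i$ is a homeomorphism of $s_E^{-1}(U_i)$ onto $s_F^{-1}(\tau U_i)$ with $s_F\gamma_i=\tau s_E$ and $r_F\gamma_i=\tau r_E$ on $s_E^{-1}(U_i)$; (C3) $U_i\cap U_j\cap U_k=\varnothing$ for distinct $i,j,k$; (C4) $\overline{U_i}\setminus U_j$ and $\overline{U_j}\setminus U_i$ are disjoint for $i\ne j$; (C5) if $U_i\cap U_j\neq\varnothing$, there is a permutation $\pi^E_{i,j}\in S_m$ such that $U_{ik}\cap U_{jl}\ne\varnothing$ if and only if $l=\pi^E_{i,j}(k)$; (C6) the sets $V_i=\tau(U_i)$ and $V_{ik}=\gamma_i(U_{ik})$ satisfy (C5) as well, with permutations $\pi^F_{i,j}$. Suppose that for some $i_0,j_0$ with $U_{i_0}\cap U_{j_0}\ne\varnothing$ and some $k_0\ne l_0$ we have $\pi^E_{i_0,j_0}=\pi^F_{i_0,j_0}\circ(k_0\,l_0)$, while $\pi^E_{i,j}=\pi^F_{i,j}$ whenever $U_i\cap U_j\neq\varnothing$ and $\{i,j\}\neq\{i_0,j_0\}$.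 Then $\mathcal X(E)$ and $\mathcal X(F)$ are unitarily equivalent as C*-correspondences: with $\rho:C(E^0)\to C(F^0)$, $\rho(f)=f\circ\tau^{-1}$, there is a linear bijection $\Gamma:\mathcal X(E)\to\mathcal X(F)$ such that $\langle\Gamma x,\Gamma y\rangle=\rho(\langle x,y\rangle)$ and $\Gamma(f\cdot x\cdot g)=\rho(f)\cdot\Gamma(x)\cdot\rho(g)$ for all $x,y\in\mathcal X(E)$ and $f,g\in C(E^0)$. Moreover, $\Gamma$ can be chosen of the following form. There is a continuous function $g:F^0\to[0,\pi/2]$ with $g=0$ on $\overline{V_{i_0}}\setminus V_{j_0}$ and $g=\pi/2$ on $\overline{V_{j_0}}\setminus V_{i_0}$ such that, with $h=g\circ s_F$, $P=V_{i_0k_0}\cap V_{j_0\pi^F_{i_0,j_0}(k_0)}$ and $Q=V_{i_0l_0}\cap V_{j_0\pi^F_{i_0,j_0}(l_0)}$, \[ \Gamma(x)(a)=\begin{cases} x(\gamma_i^{-1}(a)) & \text{if } s_F(a)\in V_i,\ a\notin P\cup Q,\\ \cos(h(a))\,x(\gamma_{i_0}^{-1}(a))+\sin(h(a))\,x(\gamma_{j_0}^{-1}(a))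 & \text{if } a\in P,\\ e^{2\mathrm i h(a)}\big(\cos(h(a))\,x(\gamma_{i_0}^{-1}(a))-\sin(h(a))\,x(\gamma_{j_0}^{-1}(a))\big) & \text{if } a\in Q . \end{cases} \] -/

import Mathlib

open scoped ComplexOrder

/-- `X` has Lebesgue covering dimension at most `d`: every finite open cover has an open
refinement such that each point lies in at most `d + 1` of its members. -/
def CoveringDimLE (X : Type*) [TopologicalSpace X] (d : ℕ) : Prop :=
  ∀ 𝒪 : Set (Set X), 𝒪.Finite → (∀ O ∈ 𝒪, IsOpen O) → ⋃₀ 𝒪 = Set.univ →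
    ∃ 𝒬 : Set (Set X), (∀ Q ∈ 𝒬, IsOpen Q) ∧ ⋃₀ 𝒬 = Set.univ ∧
      (∀ Q ∈ 𝒬, ∃ O ∈ 𝒪, Q ⊆ O) ∧ ∀ x, {Q ∈ 𝒬 | x ∈ Q}.encard ≤ d + 1

/-- A topological graph with base space `V` and edge space `W`. It is a compact topological
graph when `V` and `W` are compact Hausdorff spaces. -/
structure TopologicalGraph (V W : Type*) [TopologicalSpace V] [TopologicalSpace W] where
  /-- the range map -/
  r : W → V
  /-- the source map -/
  s : W → V
  isProperMap_r : IsProperMap r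
  isLocalHomeomorph_s : IsLocalHomeomorph s

/-- A C⋆-correspondence `X` over a commutative unital C⋆-algebra `A`: a complete Hilbert
`A`-module (whose right action is written `a • x`; the inner product is linear in the second
variable) with a left action of `A` by adjointable operators that is a `⋆`-homomorphism. -/
class CStarCorrespondence (A X : Type*) [CommCStarAlgebra A] [PartialOrder A]
    [NormedAddCommGroup X] [NormedSpace ℂ X] [SMul A X] [CStarModule A X] [CompleteSpace X] where
  /-- the left action -/
  left : A →ₙₐ[ℂ] Module.End ℂ X
  inner_left : ∀ (a : A) (x y : X), inner A (left a x) y = inner A x (left (star a) y)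

/-- A unitary equivalence from a C⋆-correspondence `X` over `A` to a C⋆-correspondence `Y`
over `B`, relative to a `⋆`-isomorphism `ρ : A → B` of the coefficient algebras: a linear
bijection that preserves inner products and both module actions. -/
structure CorrespondenceUnitary {A B : Type*} [CommCStarAlgebra A] [PartialOrder A]
    [CommCStarAlgebra B] [PartialOrder B] (ρ : A ≃⋆ₐ[ℂ] B) (X Y : Type*)
    [NormedAddCommGroup X] [NormedSpace ℂ X] [SMul A X] [CStarModule A X] [CompleteSpace X]
    [CStarCorrespondence A X]
    [NormedAddCommGroup Y] [NormedSpace ℂ Y] [SMul B Y] [CStarModule B Y] [CompleteSpace Y]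
    [CStarCorrespondence B Y] extends X ≃ₗ[ℂ] Y where
  map_inner : ∀ x y : X, inner B (toFun x) (toFun y) = ρ (inner A x y)
  map_right : ∀ (a : A) (x : X), toFun (a • x) = ρ a • toFun x
  map_left : ∀ (a : A) (x : X), toFun (CStarCorrespondence.left a x) =
    CStarCorrespondence.left (ρ a) (toFun x)

namespace TopologicalGraph

noncomputable section

variable {V W : Type*} [TopologicalSpace V] [TopologicalSpace W]

section FiberSum

variable [T2Space V] [CompactSpace W] [T2Space W] (E : TopologicalGraph V W)

theorem finite_fiber (v : V) : (E.s ⁻¹' {v}).Finite := by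
  have h := isLocalHomeomorph_iff_isCoveringMap.mp E.isLocalHomeomorph_s
  have : DiscreteTopology (E.s ⁻¹' {v}) := (h v).discreteTopology_fiber
  have hc : IsCompact (E.s ⁻¹' {v}) :=
    (isClosed_singleton.preimage E.isLocalHomeomorph_s.continuous).isCompact
  exact hc.finite (isDiscrete_iff_discreteTopology.mpr this)

/-- The sum of `f` over the (finite) fibre of the source map over `v`. -/
def fiberSum (f : W → ℂ) (v : V) : ℂ := ∑ e ∈ (E.finite_fiber v).toFinset, f e

theorem continuous_fiberSum (f : C(W, ℂ)) : Continuous (E.fiberSum f) := by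
  rw [continuous_iff_continuousAt]
  intro v
  obtain ⟨_, U, hvU, hU, _, H, hH⟩ :=
    isLocalHomeomorph_iff_isCoveringMap.mp E.isLocalHomeomorph_s v
  have : Fintype (E.s ⁻¹' {v}) := (E.finite_fiber v).fintype
  have key : ∀ u : U, E.fiberSum f u = ∑ i : E.s ⁻¹' {v}, f (H.symm (u, i)) := by
    intro u
    symm
    refine Finset.sum_bij (fun i _ => ((H.symm (u, i) : E.s ⁻¹' U) : W)) ?_ ?_ ?_ ?_
    · intro i _
      simp [← hH]
    · intro i _ j _ hij
      simpa using H.symm.injective (Subtype.ext hij)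
    · intro e he
      have he' : E.s e = u := by simpa using he
      have hm : e ∈ E.s ⁻¹' U := by rw [Set.mem_preimage, he']; exact u.2
      refine ⟨(H ⟨e, hm⟩).2, Finset.mem_univ _, ?_⟩
      have : (u, (H ⟨e, hm⟩).2) = H ⟨e, hm⟩ :=
        Prod.ext (Subtype.ext (by rw [hH]; exact he'.symm)) rfl
      rw [this]
      simp
    · intro _ _
      rfl
  have hc : ContinuousOn (E.fiberSum f) U := by
    rw [continuousOn_iff_continuous_domRestrict]
    refine Continuous.congr (f := fun u : U => ∑ i : E.s ⁻¹' {v}, f (H.symm (u, i))) ?_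
      fun u => (key u).symm
    fun_prop
  exact hc.continuousAt (hU.mem_nhds hvU)

end FiberSum

/-- The C⋆-correspondence of a compact topological graph. Since the edge space `W` is compact,
`C_c(W) = C(W)`, and this space is complete in the norm of the correspondence (see the
`CompleteSpace` instance below), so that it equals its completion. -/
def Correspondence (_ : TopologicalGraph V W) : Type _ := C(W, ℂ)

namespace Correspondence

section Basic

variable {E : TopologicalGraph V W}

instance : FunLike E.Correspondence W ℂ := inferInstanceAs (FunLike C(W, ℂ) W ℂ)
instance : AddCommGroup E.Correspondence := inferInstanceAs (AddCommGroup C(W, ℂ))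
instance : Module ℂ E.Correspondence := inferInstanceAs (Module ℂ C(W, ℂ))

/-- An element of the correspondence as a continuous function on the edge space, and back. -/
def toMap : E.Correspondence ≃ₗ[ℂ] C(W, ℂ) := LinearEquiv.refl ℂ C(W, ℂ)

@[ext]
theorem ext {x y : E.Correspondence} (h : ∀ e, x e = y e) : x = y := DFunLike.ext _ _ h

@[simp] theorem toMap_apply (x : E.Correspondence) (e : W) : toMap x e = x e := rfl
@[simp] theorem toMap_symm_apply (x : C(W, ℂ)) (e : W) :
    (toMap.symm x : E.Correspondence) e = x e := rfl
@[simp] theorem add_apply (x y : E.Correspondence) (e : W) : (x + y) e = x e + y e := rfl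
@[simp] theorem zero_apply (e : W) : (0 : E.Correspondence) e = 0 := rfl
@[simp] theorem smul_apply (c : ℂ) (x : E.Correspondence) (e : W) : (c • x) e = c * x e := rfl

/-- The right action `(x · g)(e) = x(e) g(s(e))`. -/
instance : SMul C(V, ℂ) E.Correspondence where
  smul g x := toMap.symm (toMap x * g.comp ⟨E.s, E.isLocalHomeomorph_s.continuous⟩)

@[simp] theorem right_apply (g : C(V, ℂ)) (x : E.Correspondence) (e : W) :
    (g • x) e = x e * g (E.s e) := rfl

/-- The left action `(f · x)(e) = f(r(e)) x(e)`. -/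
def leftAction : C(V, ℂ) →ₙₐ[ℂ] Module.End ℂ E.Correspondence where
  toFun f :=
    { toFun := fun x => toMap.symm (f.comp ⟨E.r, E.isProperMap_r.continuous⟩ * toMap x)
      map_add' := fun x y => by ext e; simp [mul_add]
      map_smul' := fun c x => by ext e; simp; ring }
  map_smul' c f := by ext x e; simp; ring
  map_zero' := by ext x e; simp
  map_add' f g := by ext x e; simp [add_mul]
  map_mul' f g := by ext x e; simp [mul_assoc]

@[simp] theorem leftAction_apply (f : C(V, ℂ)) (x : E.Correspondence) (e : W) :
    leftAction f x e = f (E.r e) * x e := rfl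

end Basic

section Hilbert

variable [T2Space V] [CompactSpace W] [T2Space W] {E : TopologicalGraph V W}

/-- The inner product `⟨x, y⟩(v) = ∑_{s(e) = v} conj(x(e)) y(e)`. -/
instance : Inner C(V, ℂ) E.Correspondence where
  inner x y := ⟨E.fiberSum fun e => star (x e) * y e,
    E.continuous_fiberSum (star (toMap x) * toMap y)⟩

theorem inner_apply (x y : E.Correspondence) (v : V) :
    inner C(V, ℂ) x y v = ∑ e ∈ (E.finite_fiber v).toFinset, star (x e) * y e := rfl

variable [CompactSpace V]

/-- The norm `‖x‖ = ‖⟨x, x⟩‖^{1/2}`. -/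
instance : Norm E.Correspondence := CStarModule.norm C(V, ℂ)

instance : CStarModule C(V, ℂ) E.Correspondence where
  inner_add_right := by
    intro x y z; ext v; simp [inner_apply, mul_add, Finset.sum_add_distrib]
  inner_self_nonneg := by
    intro x v
    exact Finset.sum_nonneg fun e _ => star_mul_self_nonneg (x e)
  inner_self := by
    intro x
    refine ⟨fun h => ?_, fun h => by subst h; ext v; simp [inner_apply]⟩
    ext e
    have h1 := DFunLike.congr_fun h (E.s e)
    rw [inner_apply, ContinuousMap.zero_apply,
      Finset.sum_eq_zero_iff_of_nonneg fun e _ => star_mul_self_nonneg (x e)] at h1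
    have h2 := h1 e (by simp)
    simpa using h2
  inner_op_smul_right := by
    intro g x y; ext v
    simp only [inner_apply, right_apply, ContinuousMap.mul_apply, Finset.mul_sum]
    refine Finset.sum_congr rfl fun e he => ?_
    have he' : E.s e = v := by simpa using he
    rw [he']; ring
  inner_smul_right_complex := by
    intro z x y; ext v
    simp only [inner_apply, smul_apply, ContinuousMap.smul_apply, smul_eq_mul, Finset.mul_sum]
    exact Finset.sum_congr rfl fun e _ => by ring
  star_inner := by
    intro x y; ext v; simp [inner_apply, mul_comm]
  norm_eq_sqrt_norm_inner_self := fun _ => rfl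

instance : NormedAddCommGroup E.Correspondence :=
  CStarModule.normedAddCommGroup C(V, ℂ)

instance : NormedSpace ℂ E.Correspondence :=
  NormedSpace.ofCore (CStarModule.normedSpaceCore C(V, ℂ))

theorem norm_apply_le (x : E.Correspondence) (e : W) : ‖x e‖ ≤ ‖x‖ := by
  have h1 : ‖x‖ ^ 2 = ‖inner C(V, ℂ) x x‖ := CStarModule.norm_sq_eq C(V, ℂ)
  have h2 := (inner C(V, ℂ) x x).norm_coe_le_norm (E.s e)
  have h3 : inner C(V, ℂ) x x (E.s e) =
      ((∑ e ∈ (E.finite_fiber (E.s e)).toFinset, ‖x e‖ ^ 2 : ℝ) : ℂ) := by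
    rw [inner_apply]
    push_cast
    exact Finset.sum_congr rfl fun e _ => by
      simpa using Complex.conj_mul' (x e)
  have h4 : ‖x e‖ ^ 2 ≤ ∑ e ∈ (E.finite_fiber (E.s e)).toFinset, ‖x e‖ ^ 2 :=
    Finset.single_le_sum (f := fun e => ‖x e‖ ^ 2) (fun _ _ => by positivity) (by simp)
  rw [h3, Complex.norm_real, Real.norm_of_nonneg (Finset.sum_nonneg fun _ _ => by positivity),
    ← h1] at h2
  exact le_of_sq_le_sq (h4.trans h2) (norm_nonneg x)

theorem norm_le_mul (x : C(W, ℂ)) :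
    ‖(toMap.symm x : E.Correspondence)‖ ≤
      ‖(toMap.symm 1 : E.Correspondence)‖ * ‖x‖ := by
  set y : E.Correspondence := toMap.symm x
  set u : E.Correspondence := toMap.symm 1
  have h1 : ‖y‖ ^ 2 = ‖inner C(V, ℂ) y y‖ := CStarModule.norm_sq_eq C(V, ℂ)
  have h2 : ‖u‖ ^ 2 = ‖inner C(V, ℂ) u u‖ := CStarModule.norm_sq_eq C(V, ℂ)
  refine le_of_sq_le_sq ?_ (by positivity)
  rw [mul_pow, h1, h2, ContinuousMap.norm_le _ (by positivity)]
  intro v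
  have h3 := (inner C(V, ℂ) u u).norm_coe_le_norm v
  have h4 : ‖inner C(V, ℂ) u u v‖ = (E.finite_fiber v).toFinset.card := by
    simp [inner_apply, u]
  rw [h4] at h3
  refine le_trans ?_ (mul_le_mul_of_nonneg_right h3 (by positivity))
  rw [inner_apply, ← nsmul_eq_mul]
  refine (norm_sum_le _ _).trans (Finset.sum_le_card_nsmul _ _ _ fun e _ => ?_)
  rw [norm_mul, norm_star, sq]
  exact mul_self_le_mul_self (norm_nonneg _) (x.norm_coe_le_norm e)

instance : CompleteSpace E.Correspondence := by
  let Φ : E.Correspondence ≃L[ℂ] C(W, ℂ) :=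
    toMap.toContinuousLinearEquivOfBounds 1 ‖(toMap.symm 1 : E.Correspondence)‖
      (fun x => by
        rw [one_mul, ContinuousMap.norm_le _ (norm_nonneg _)]
        exact norm_apply_le x)
      norm_le_mul
  exact (completeSpace_congr (e := Φ.toLinearEquiv.toEquiv) Φ.isUniformEmbedding).mpr inferInstance

instance : CStarCorrespondence C(V, ℂ) E.Correspondence where
  left := leftAction
  inner_left f x y := by
    ext v
    simp only [inner_apply, leftAction_apply]
    exact Finset.sum_congr rfl fun e _ => by simp; ring

end Hilbert

end Correspondence

end

end TopologicalGraph

open scoped Topology in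
/-- The topological graphs `E` and `F` are locally conjugate via `τ`. -/
def LocallyConjugateVia {V W V' W' : Type*} [TopologicalSpace V] [TopologicalSpace W]
    [TopologicalSpace V'] [TopologicalSpace W'] (E : TopologicalGraph V W)
    (F : TopologicalGraph V' W') (τ : V ≃ₜ V') : Prop :=
  ∀ u : V, ∃ U ∈ 𝓝 u, ∃ γ : (E.s ⁻¹' U) ≃ₜ (F.s ⁻¹' (τ '' U)),
    (∀ e, F.s (γ e) = τ (E.s e)) ∧ (∀ e, F.r (γ e) = τ (E.r e))

/-- The sheets `S i k` over the sets `U i` overlap by permutations: whenever `U i` and `U j`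
meet, there is a bijection `π` such that `S i k` meets `S j l` if and only if `l = π k`. -/
def OverlapByPermutations {X Y : Type*} {n : ℕ} {m : Fin n → ℕ} (U : Fin n → Set X)
    (S : (i : Fin n) → Fin (m i) → Set Y) : Prop :=
  ∀ i j, (U i ∩ U j).Nonempty →
    ∃ π : Fin (m i) ≃ Fin (m j), ∀ k l, (S i k ∩ S j l).Nonempty ↔ l = π k

/-- An admissible open cover `U 0, …, U (n - 1)` of the base space of `E`, where `E` and `F`
are locally conjugate via `τ`, with `m i` sheets over `U i`, together with its sheets
`sheet i k` and the local conjugacies `γ i`. -/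
structure AdmissibleCover {V W V' W' : Type*} [TopologicalSpace V] [TopologicalSpace W]
    [TopologicalSpace V'] [TopologicalSpace W'] (E : TopologicalGraph V W)
    (F : TopologicalGraph V' W') (τ : V ≃ₜ V') (n : ℕ) (m : Fin n → ℕ) where
  U : Fin n → Set V
  isOpen_U : ∀ i, IsOpen (U i)
  iUnion_U : ⋃ i, U i = Set.univ
  sheet : (i : Fin n) → Fin (m i) → Set W
  isOpen_sheet : ∀ i k, IsOpen (sheet i k)
  disjoint_sheet : ∀ i, Pairwise fun k l => Disjoint (sheet i k) (sheet i l)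
  iUnion_sheet : ∀ i, E.s ⁻¹' U i = ⋃ k, sheet i k
  /-- the source map restricts to a homeomorphism of each sheet over `U i` onto `U i` -/
  homeo_sheet : ∀ i k, ∃ h : sheet i k ≃ₜ U i, ∀ e, (h e : V) = E.s e
  γ : (i : Fin n) → (E.s ⁻¹' U i) ≃ₜ (F.s ⁻¹' (τ '' U i))
  s_γ : ∀ i e, F.s (γ i e) = τ (E.s e)
  r_γ : ∀ i e, F.r (γ i e) = τ (E.r e)
  inter_eq_empty : ∀ i j k, i ≠ j → j ≠ k → k ≠ i → U i ∩ U j ∩ U k = ∅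
  disjoint_diff : ∀ i j, i ≠ j → Disjoint (closure (U i) \ U j) (closure (U j) \ U i)
  overlap_E : OverlapByPermutations U sheet
  overlap_F : OverlapByPermutations (fun i => τ '' U i)
    (fun i k => (fun e => (γ i e : W')) '' {e | (e : W) ∈ sheet i k})

namespace AdmissibleCover

variable {V W V' W' : Type*} [TopologicalSpace V] [TopologicalSpace W]
  [TopologicalSpace V'] [TopologicalSpace W'] {E : TopologicalGraph V W}
  {F : TopologicalGraph V' W'} {τ : V ≃ₜ V'} {n : ℕ} {m : Fin n → ℕ}
  (𝒰 : AdmissibleCover E F τ n m)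

/-- The corresponding cover of the base space of `F`: the image of `U i` under `τ`. -/
def baseF (i : Fin n) : Set V' := τ '' 𝒰.U i

/-- The corresponding sheets in the edge space of `F`: the image of `sheet i k` under `γ i`. -/
def sheetF (i : Fin n) (k : Fin (m i)) : Set W' :=
  (fun e => (𝒰.γ i e : W')) '' {e | (e : W) ∈ 𝒰.sheet i k}

/-- The overlap permutation of `E` for an intersecting pair. -/
noncomputable def permE (i j : Fin n) (h : (𝒰.U i ∩ 𝒰.U j).Nonempty) : Fin (m i) ≃ Fin (m j) :=
  (𝒰.overlap_E i j h).choose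

theorem permE_spec (i j : Fin n) (h : (𝒰.U i ∩ 𝒰.U j).Nonempty) (k : Fin (m i))
    (l : Fin (m j)) : (𝒰.sheet i k ∩ 𝒰.sheet j l).Nonempty ↔ l = 𝒰.permE i j h k :=
  (𝒰.overlap_E i j h).choose_spec k l

theorem nonempty_baseF_inter {i j : Fin n} (h : (𝒰.U i ∩ 𝒰.U j).Nonempty) :
    (𝒰.baseF i ∩ 𝒰.baseF j).Nonempty := by
  obtain ⟨v, hi, hj⟩ := h
  exact ⟨τ v, ⟨v, hi, rfl⟩, ⟨v, hj, rfl⟩⟩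

/-- The overlap permutation of `F` for an intersecting pair. -/
noncomputable def permF (i j : Fin n) (h : (𝒰.U i ∩ 𝒰.U j).Nonempty) : Fin (m i) ≃ Fin (m j) :=
  (𝒰.overlap_F i j (𝒰.nonempty_baseF_inter h)).choose

theorem permF_spec (i j : Fin n) (h : (𝒰.U i ∩ 𝒰.U j).Nonempty) (k : Fin (m i))
    (l : Fin (m j)) : (𝒰.sheetF i k ∩ 𝒰.sheetF j l).Nonempty ↔ l = 𝒰.permF i j h k :=
  (𝒰.overlap_F i j (𝒰.nonempty_baseF_inter h)).choose_spec k l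

/-- The inverse of the local conjugacy `γ i`, on an edge of `F` whose source lies in `baseF i`. -/
def γinv (i : Fin n) (a : W') (ha : F.s a ∈ 𝒰.baseF i) : W := (𝒰.γ i).symm ⟨a, ha⟩

end AdmissibleCover

/-! A linear map of the form `x ↦ (a ↦ ∑ M a e * x e)`, summed over the fibre of `E.s` over `τ⁻¹(F.s
a)`, is a unitary of correspondences as soon as the kernel `M` is continuous on the fibre product,
unitary on each pair of fibres, and supported on pairs `(a, e)` with `F.r a = τ (E.r e)`. This is
`exists_unitary_of_kernel`. Over one set of the cover the sheets turn `M` into an `m × m` matrix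
function, so continuity and unitarity may be checked there (`exists_unitary_of_local_matrices`).

In the sheets over `U i`, the conjugacy `γ i` is the identity matrix. All conjugacies agree wherever
they are jointly defined, except on the sheets `k₀`, `l₀` over the overlap of `i₀` and `j₀`, where
`γ j₀` reads as the transposition of `k₀` and `l₀`. The kernel must therefore follow a path of
unitary `2 × 2` matrices from the identity to the flip. The path with rows `(cos g, sin g)` and
`e^{2ig}(-sin g, cos g)` does this: the plain rotation would end with the wrong sign, and the phase,
equal to `-1` at `g = π/2`, corrects it. Mixing the two edges does not disturb the left action,
because both have the same range. (C4) provides `g` by Urysohn's lemma, and (C3) keeps every third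
set of the cover away from the overlap (`exists_matrix_rotationKernel`). -/

namespace TopologicalGraph

/-! ### Unitaries given by kernels on the fibre product -/

section Kernel

variable {V W V' W' : Type*} [TopologicalSpace V] [TopologicalSpace W]
  [TopologicalSpace V'] [TopologicalSpace W']

/-- Summing a continuous kernel over the fibres of the source map gives a continuous function. -/
theorem continuous_sum_fiber {Z : Type*} [TopologicalSpace Z] [T2Space V] [CompactSpace W]
    [T2Space W] (E : TopologicalGraph V W) {f : Z → V} (hf : Continuous f) {K : Z → W → ℂ}
    (hK : ContinuousOn (fun p : Z × W => K p.1 p.2) {p | E.s p.2 = f p.1}) :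
    Continuous fun z => ∑ e ∈ (E.finite_fiber (f z)).toFinset, K z e := by
  rw [continuous_iff_continuousAt]
  intro z
  -- A local homeomorphism between these spaces is a covering map, so near `f z` all fibres are
  -- indexed by the one finite fibre over `f z`, and the sum has a fixed index set.
  obtain ⟨_, U, hvU, hU, _, H, hH⟩ :=
    isLocalHomeomorph_iff_isCoveringMap.mp E.isLocalHomeomorph_s (f z)
  have : Fintype (E.s ⁻¹' {f z}) := (E.finite_fiber (f z)).fintype
  have hs : ∀ (u : U) i, E.s (H.symm (u, i)) = u := fun u i => by simp [← hH]
  have key : ∀ t : f ⁻¹' U, ∑ e ∈ (E.finite_fiber (f t)).toFinset, K t e =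
      ∑ i : E.s ⁻¹' {f z}, K t (H.symm (⟨f t, t.2⟩, i)) := by
    intro t
    symm
    refine Finset.sum_bij (fun i _ => ((H.symm (⟨f t, t.2⟩, i) : E.s ⁻¹' U) : W)) ?_ ?_ ?_ ?_
    · intro i _
      simp [hs]
    · intro i _ j _ hij
      simpa using H.symm.injective (Subtype.ext hij)
    · intro e he
      have he' : E.s e = f t := by simpa using he
      have hm : e ∈ E.s ⁻¹' U := by rw [Set.mem_preimage, he']; exact t.2
      refine ⟨(H ⟨e, hm⟩).2, Finset.mem_univ _, ?_⟩
      have : ((⟨f t, t.2⟩ : U), (H ⟨e, hm⟩).2) = H ⟨e, hm⟩ :=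
        Prod.ext (Subtype.ext (by rw [hH]; exact he'.symm)) rfl
      rw [this]
      simp
    · intro _ _
      rfl
  have hc : ContinuousOn (fun z => ∑ e ∈ (E.finite_fiber (f z)).toFinset, K z e) (f ⁻¹' U) := by
    rw [continuousOn_iff_continuous_domRestrict]
    refine Continuous.congr
      (f := fun t : f ⁻¹' U => ∑ i : E.s ⁻¹' {f z}, K t (H.symm (⟨f t, t.2⟩, i))) ?_
      fun t => (key t).symm
    refine continuous_finsetSum _ fun i _ => ?_
    -- The moving edge stays in the fibre product, the only place where `K` is known to be
    -- continuous.
    exact hK.comp_continuous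
      (f := fun t : f ⁻¹' U => ((t : Z), ((H.symm (⟨f t, t.2⟩, i) : E.s ⁻¹' U) : W)))
      (by fun_prop) fun t => hs _ _
  exact hc.continuousAt ((hU.preimage hf).mem_nhds hvU)

variable [CompactSpace V] [T2Space V] [CompactSpace W] [T2Space W]
  [CompactSpace V'] [T2Space V'] [CompactSpace W'] [T2Space W']

open Classical in
/-- A fibrewise unitary continuous kernel that intertwines the range maps induces a unitary
equivalence of correspondences. -/
theorem exists_unitary_of_kernel (E : TopologicalGraph V W) (F : TopologicalGraph V' W')
    (τ : V ≃ₜ V') (M : W' → W → ℂ)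
    (hM : ContinuousOn (fun p : W' × W => M p.1 p.2) {p | F.s p.1 = τ (E.s p.2)})
    (hr : ∀ a e, F.s a = τ (E.s e) → M a e ≠ 0 → F.r a = τ (E.r e))
    (hiso : ∀ e e', E.s e = E.s e' →
      ∑ a ∈ (F.finite_fiber (τ (E.s e))).toFinset, star (M a e) * M a e' = if e = e' then 1 else 0)
    (hcoiso : ∀ a a', F.s a = F.s a' →
      ∑ e ∈ (E.finite_fiber (τ.symm (F.s a))).toFinset, M a e * star (M a' e) =
        if a = a' then 1 else 0) :
    ∃ Γ : CorrespondenceUnitary (τ.symm.compStarAlgEquiv' ℂ ℂ) E.Correspondence F.Correspondence,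
      ∀ x a, Γ.toLinearEquiv x a =
        ∑ e ∈ (E.finite_fiber (τ.symm (F.s a))).toFinset, M a e * x e := by
  have hsE := E.isLocalHomeomorph_s.continuous
  have hsF := F.isLocalHomeomorph_s.continuous
  have hx (x : E.Correspondence) : Continuous fun e => x e := map_continuous (Correspondence.toMap x)
  have hy (y : F.Correspondence) : Continuous fun a => y a := map_continuous (Correspondence.toMap y)
  let T : E.Correspondence → F.Correspondence := fun x => Correspondence.toMap.symm
    ⟨fun a => ∑ e ∈ (E.finite_fiber (τ.symm (F.s a))).toFinset, M a e * x e, by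
      refine E.continuous_sum_fiber (f := fun a => τ.symm (F.s a)) (by fun_prop)
        (K := fun a e => M a e * x e) ?_
      refine ContinuousOn.mul (hM.mono fun p hp => ?_) (by have := hx x; fun_prop)
      have : E.s p.2 = τ.symm (F.s p.1) := hp
      simp [this]⟩
  -- The fibrewise adjoint of `T`, which will be its inverse.
  let S : F.Correspondence → E.Correspondence := fun y => Correspondence.toMap.symm
    ⟨fun e => ∑ a ∈ (F.finite_fiber (τ (E.s e))).toFinset, star (M a e) * y a, by
      refine F.continuous_sum_fiber (f := fun e => τ (E.s e)) (by fun_prop)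
        (K := fun e a => star (M a e) * y a) ?_
      refine ContinuousOn.mul ?_ (by have := hy y; fun_prop)
      exact (hM.comp (f := Prod.swap) (by fun_prop) fun p hp => hp).star⟩
  have hT : ∀ x a, T x a = ∑ e ∈ (E.finite_fiber (τ.symm (F.s a))).toFinset, M a e * x e :=
    fun _ _ => rfl
  have hS : ∀ y e, S y e = ∑ a ∈ (F.finite_fiber (τ (E.s e))).toFinset, star (M a e) * y a :=
    fun _ _ => rfl
  have hST : ∀ x, S (T x) = x := by
    intro x
    ext e
    rw [hS]
    calc _ = ∑ a ∈ (F.finite_fiber (τ (E.s e))).toFinset,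
          ∑ e' ∈ (E.finite_fiber (E.s e)).toFinset, star (M a e) * M a e' * x e' := by
          refine Finset.sum_congr rfl fun a ha => ?_
          have ha : F.s a = τ (E.s e) := by simpa using ha
          rw [hT, Finset.mul_sum, ha, τ.symm_apply_apply]
          simp only [mul_assoc]
      _ = ∑ e' ∈ (E.finite_fiber (E.s e)).toFinset, (if e = e' then 1 else 0) * x e' := by
          rw [Finset.sum_comm]
          refine Finset.sum_congr rfl fun e' he' => ?_
          rw [← Finset.sum_mul, hiso e e' (by simpa [eq_comm] using he')]
      _ = x e := by simp
  have hTS : ∀ y, T (S y) = y := by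
    intro y
    ext a
    rw [hT]
    calc _ = ∑ e ∈ (E.finite_fiber (τ.symm (F.s a))).toFinset,
          ∑ a' ∈ (F.finite_fiber (F.s a)).toFinset, M a e * star (M a' e) * y a' := by
          refine Finset.sum_congr rfl fun e he => ?_
          have he : E.s e = τ.symm (F.s a) := by simpa using he
          rw [hS, Finset.mul_sum, he, τ.apply_symm_apply]
          simp only [mul_assoc]
      _ = ∑ a' ∈ (F.finite_fiber (F.s a)).toFinset, (if a = a' then 1 else 0) * y a' := by
          rw [Finset.sum_comm]
          refine Finset.sum_congr rfl fun a' ha' => ?_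
          rw [← Finset.sum_mul, hcoiso a a' (by simpa [eq_comm] using ha')]
      _ = y a := by simp
  refine ⟨{ toFun := T, invFun := S, left_inv := hST, right_inv := hTS,
            map_add' := ?_, map_smul' := ?_, map_inner := ?_, map_right := ?_, map_left := ?_ }, ?_⟩
  · intro x y
    ext a
    simp [hT, mul_add, Finset.sum_add_distrib]
  · intro c x
    ext a
    simp only [hT, Correspondence.smul_apply, RingHom.id_apply, Finset.mul_sum]
    exact Finset.sum_congr rfl fun e _ => by ring
  · intro x y
    ext v
    change inner C(V', ℂ) (T x) (T y) v = inner C(V, ℂ) x y (τ.symm v)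
    -- Inner products are preserved because `⟨Tx, Ty⟩ = ⟨x, S(Ty)⟩` fibrewise and `S ∘ T` is the
    -- identity.
    have hy' : ∀ e ∈ (E.finite_fiber (τ.symm v)).toFinset,
        ∑ a ∈ (F.finite_fiber v).toFinset, star (M a e) * T y a = y e := by
      intro e he
      have he : E.s e = τ.symm v := by simpa using he
      have := hS (T y) e
      rw [hST, he, τ.apply_symm_apply] at this
      exact this.symm
    rw [Correspondence.inner_apply, Correspondence.inner_apply]
    calc _ = ∑ a ∈ (F.finite_fiber v).toFinset, ∑ e ∈ (E.finite_fiber (τ.symm v)).toFinset,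
          star (x e) * (star (M a e) * T y a) := by
          refine Finset.sum_congr rfl fun a ha => ?_
          have ha : F.s a = v := by simpa using ha
          rw [hT, ha, star_sum, Finset.sum_mul]
          exact Finset.sum_congr rfl fun e _ => by rw [star_mul]; ring
      _ = _ := by
          rw [Finset.sum_comm]
          exact Finset.sum_congr rfl fun e he => by rw [← Finset.mul_sum, hy' e he]
  · intro f x
    ext a
    change T (f • x) a = T x a * f (τ.symm (F.s a))
    simp only [hT, Correspondence.right_apply, Finset.sum_mul]
    refine Finset.sum_congr rfl fun e he => ?_
    have he : E.s e = τ.symm (F.s a) := by simpa using he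
    rw [he, mul_assoc]
  · intro f x
    ext a
    change T (Correspondence.leftAction f x) a = f (τ.symm (F.r a)) * T x a
    simp only [hT, Correspondence.leftAction_apply, Finset.mul_sum]
    refine Finset.sum_congr rfl fun e he => ?_
    have he : E.s e = τ.symm (F.s a) := by simpa using he
    by_cases h0 : M a e = 0
    · simp [h0]
    · rw [hr a e (by simp [he]) h0, τ.symm_apply_apply]
      ring
  · intro x a
    rfl

end Kernel

end TopologicalGraph

/-! ### Unitary matrices acting on two coordinates -/

open Classical in
/-- The matrix that acts as `!![α, β; γ, δ]` on the coordinates `p`, `q` and as the identity on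
the others. -/
noncomputable def twoBlock {ι : Type*} (p q : ι) (α β γ δ : ℂ) : Matrix ι ι ℂ := fun k l =>
  if k = p then if l = p then α else if l = q then β else 0
  else if k = q then if l = p then γ else if l = q then δ else 0
  else if k = l then 1 else 0

theorem twoBlock_conjTranspose_mul_self {ι : Type*} [Fintype ι] [DecidableEq ι] {p q : ι}
    (hpq : p ≠ q) {α β γ δ : ℂ} (h₁ : star α * α + star γ * γ = 1)
    (h₂ : star β * β + star δ * δ = 1) (h₃ : star α * β + star γ * δ = 0) :
    (twoBlock p q α β γ δ).conjTranspose * twoBlock p q α β γ δ = 1 := by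
  have h₄ : star β * α + star δ * γ = 0 := by
    have := congrArg star h₃
    simpa [mul_comm] using this
  ext k l
  rw [Matrix.mul_apply, Matrix.one_apply]
  simp only [Matrix.conjTranspose_apply]
  by_cases hk : k = p ∨ k = q
  -- The columns `p` and `q` are supported in the rows `p` and `q`, so only two terms survive.
  · rw [Fintype.sum_eq_add p q hpq]
    · rcases hk with hk | hk <;> rcases eq_or_ne l p with hlp | hlp <;>
        rcases eq_or_ne l q with hlq | hlq <;>
        simp_all [twoBlock, hpq.symm, eq_comm (a := p) (b := l), eq_comm (a := q) (b := l)]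
    · intro i hi
      rcases hk with rfl | rfl <;> simp [twoBlock, hi.1, hi.2]
  · push Not at hk
    rw [Finset.sum_eq_single k]
    · simp [twoBlock, hk.1, hk.2]
    · intro i _ hi
      unfold twoBlock
      split_ifs <;> simp_all
    · simp

theorem twoBlock_identity {ι : Type*} [DecidableEq ι] (p q k l : ι) :
    twoBlock p q 1 0 0 1 k l = if k = l then 1 else 0 := by
  unfold twoBlock
  split_ifs <;> simp_all

theorem continuous_twoBlock_apply {X ι : Type*} [TopologicalSpace X] (p q k l : ι)
    {α β γ δ : X → ℂ} (hα : Continuous α) (hβ : Continuous β) (hγ : Continuous γ)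
    (hδ : Continuous δ) : Continuous fun x => twoBlock p q (α x) (β x) (γ x) (δ x) k l := by
  unfold twoBlock
  split_ifs <;> fun_prop

/-! ### Sheets, conjugacies and overlap permutations of an admissible cover -/

namespace AdmissibleCover

variable {V W V' W' : Type*} [TopologicalSpace V] [TopologicalSpace W]
  [TopologicalSpace V'] [TopologicalSpace W'] {E : TopologicalGraph V W}
  {F : TopologicalGraph V' W'} {τ : V ≃ₜ V'} {n : ℕ} {m : Fin n → ℕ}
  (𝒰 : AdmissibleCover E F τ n m)

theorem s_mem_of_mem_sheet {i : Fin n} {k : Fin (m i)} {e : W} (he : e ∈ 𝒰.sheet i k) :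
    E.s e ∈ 𝒰.U i := by
  have : e ∈ E.s ⁻¹' 𝒰.U i := by rw [𝒰.iUnion_sheet]; exact Set.mem_iUnion_of_mem k he
  exact this

theorem exists_mem_sheet {i : Fin n} {e : W} (he : E.s e ∈ 𝒰.U i) : ∃ k, e ∈ 𝒰.sheet i k := by
  have : e ∈ E.s ⁻¹' 𝒰.U i := he
  rw [𝒰.iUnion_sheet] at this
  exact Set.mem_iUnion.mp this

theorem sheet_index_unique {i : Fin n} {k l : Fin (m i)} {e : W} (hk : e ∈ 𝒰.sheet i k)
    (hl : e ∈ 𝒰.sheet i l) : k = l := by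
  by_contra h
  exact Set.disjoint_left.mp (𝒰.disjoint_sheet i h) hk hl

theorem eq_of_mem_sheet {i : Fin n} {k : Fin (m i)} {e e' : W} (he : e ∈ 𝒰.sheet i k)
    (he' : e' ∈ 𝒰.sheet i k) (h : E.s e = E.s e') : e = e' := by
  obtain ⟨φ, hφ⟩ := 𝒰.homeo_sheet i k
  have : φ ⟨e, he⟩ = φ ⟨e', he'⟩ := Subtype.ext (by rw [hφ, hφ]; exact h)
  exact congrArg Subtype.val (φ.injective this)

theorem exists_mem_sheet_over {i : Fin n} (k : Fin (m i)) {v : V} (hv : v ∈ 𝒰.U i) :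
    ∃ e ∈ 𝒰.sheet i k, E.s e = v := by
  obtain ⟨φ, hφ⟩ := 𝒰.homeo_sheet i k
  exact ⟨φ.symm ⟨v, hv⟩, (φ.symm ⟨v, hv⟩).2, by rw [← hφ]; simp⟩

theorem isOpen_baseF (i : Fin n) : IsOpen (𝒰.baseF i) :=
  τ.isOpenMap _ (𝒰.isOpen_U i)

theorem mem_baseF_iff {i : Fin n} {v : V} : τ v ∈ 𝒰.baseF i ↔ v ∈ 𝒰.U i :=
  τ.injective.mem_set_image

theorem γ_γinv {i : Fin n} {a : W'} (ha : F.s a ∈ 𝒰.baseF i) (h : E.s (𝒰.γinv i a ha) ∈ 𝒰.U i) :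
    (𝒰.γ i ⟨𝒰.γinv i a ha, h⟩ : W') = a := by
  change (𝒰.γ i ((𝒰.γ i).symm ⟨a, ha⟩) : W') = a
  simp

theorem s_γinv_mem {i : Fin n} {a : W'} (ha : F.s a ∈ 𝒰.baseF i) :
    E.s (𝒰.γinv i a ha) ∈ 𝒰.U i := ((𝒰.γ i).symm ⟨a, ha⟩).2

theorem τ_s_γinv {i : Fin n} {a : W'} (ha : F.s a ∈ 𝒰.baseF i) :
    τ (E.s (𝒰.γinv i a ha)) = F.s a := by
  rw [← 𝒰.s_γ i ⟨_, 𝒰.s_γinv_mem ha⟩, γ_γinv]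

theorem τ_r_γinv {i : Fin n} {a : W'} (ha : F.s a ∈ 𝒰.baseF i) :
    τ (E.r (𝒰.γinv i a ha)) = F.r a := by
  rw [← 𝒰.r_γ i ⟨_, 𝒰.s_γinv_mem ha⟩, γ_γinv]

theorem mem_sheetF_iff {i : Fin n} {k : Fin (m i)} {a : W'} :
    a ∈ 𝒰.sheetF i k ↔ ∃ ha : F.s a ∈ 𝒰.baseF i, 𝒰.γinv i a ha ∈ 𝒰.sheet i k := by
  constructor
  · rintro ⟨e, he, rfl⟩
    refine ⟨(𝒰.γ i e).2, ?_⟩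
    change ((𝒰.γ i).symm (𝒰.γ i e) : W) ∈ _
    simpa using he
  · rintro ⟨ha, h⟩
    exact ⟨⟨_, 𝒰.s_γinv_mem ha⟩, h, 𝒰.γ_γinv ha _⟩

theorem s_mem_of_mem_sheetF {i : Fin n} {k : Fin (m i)} {a : W'} (ha : a ∈ 𝒰.sheetF i k) :
    F.s a ∈ 𝒰.baseF i := (𝒰.mem_sheetF_iff.mp ha).1

theorem γinv_mem_sheet {i : Fin n} {k : Fin (m i)} {a : W'} (ha : a ∈ 𝒰.sheetF i k)
    (h : F.s a ∈ 𝒰.baseF i) : 𝒰.γinv i a h ∈ 𝒰.sheet i k := (𝒰.mem_sheetF_iff.mp ha).2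

theorem exists_mem_sheetF {i : Fin n} {a : W'} (ha : F.s a ∈ 𝒰.baseF i) :
    ∃ k, a ∈ 𝒰.sheetF i k := by
  obtain ⟨k, hk⟩ := 𝒰.exists_mem_sheet (𝒰.s_γinv_mem ha)
  exact ⟨k, 𝒰.mem_sheetF_iff.mpr ⟨ha, hk⟩⟩

theorem sheetF_index_unique {i : Fin n} {k l : Fin (m i)} {a : W'} (hk : a ∈ 𝒰.sheetF i k)
    (hl : a ∈ 𝒰.sheetF i l) : k = l :=
  𝒰.sheet_index_unique (𝒰.γinv_mem_sheet hk (𝒰.s_mem_of_mem_sheetF hk)) (𝒰.γinv_mem_sheet hl _)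

theorem γinv_injective {i : Fin n} {a a' : W'} (ha : F.s a ∈ 𝒰.baseF i)
    (ha' : F.s a' ∈ 𝒰.baseF i) (h : 𝒰.γinv i a ha = 𝒰.γinv i a' ha') : a = a' := by
  have := (𝒰.γ i).symm.injective (Subtype.ext h : (𝒰.γ i).symm ⟨a, ha⟩ = (𝒰.γ i).symm ⟨a', ha'⟩)
  exact congrArg Subtype.val this

theorem eq_of_mem_sheetF {i : Fin n} {k : Fin (m i)} {a a' : W'} (ha : a ∈ 𝒰.sheetF i k)
    (ha' : a' ∈ 𝒰.sheetF i k) (h : F.s a = F.s a') : a = a' :=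
  𝒰.γinv_injective (𝒰.s_mem_of_mem_sheetF ha) (𝒰.s_mem_of_mem_sheetF ha')
    (𝒰.eq_of_mem_sheet (𝒰.γinv_mem_sheet ha _) (𝒰.γinv_mem_sheet ha' _)
      (τ.injective (by rw [τ_s_γinv, τ_s_γinv, h])))

theorem exists_mem_sheetF_over {i : Fin n} (k : Fin (m i)) {v : V'} (hv : v ∈ 𝒰.baseF i) :
    ∃ a ∈ 𝒰.sheetF i k, F.s a = v := by
  obtain ⟨u, hu, rfl⟩ := hv
  obtain ⟨e, he, rfl⟩ := 𝒰.exists_mem_sheet_over k hu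
  exact ⟨𝒰.γ i ⟨e, hu⟩, ⟨⟨e, hu⟩, he, rfl⟩, 𝒰.s_γ i _⟩

theorem isOpen_sheetF (i : Fin n) (k : Fin (m i)) : IsOpen (𝒰.sheetF i k) := by
  have h₁ : IsOpen {e : E.s ⁻¹' 𝒰.U i | (e : W) ∈ 𝒰.sheet i k} :=
    (𝒰.isOpen_sheet i k).preimage continuous_subtype_val
  have h₂ := (𝒰.γ i).isOpenMap _ h₁
  have hU : IsOpen (τ '' 𝒰.U i) := 𝒰.isOpen_baseF i
  have h₃ := (hU.preimage F.isLocalHomeomorph_s.continuous).isOpenMap_subtype_val _ h₂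
  rwa [Set.image_image] at h₃

/-- The edges `a` and `e` correspond under the local conjugacy `γ i`. -/
def Corresponds (i : Fin n) (a : W') (e : W) : Prop :=
  ∃ ha : F.s a ∈ 𝒰.baseF i, 𝒰.γinv i a ha = e

theorem Corresponds.r_eq {𝒰 : AdmissibleCover E F τ n m} {i : Fin n} {a : W'} {e : W}
    (h : 𝒰.Corresponds i a e) : F.r a = τ (E.r e) := by
  obtain ⟨ha, rfl⟩ := h
  exact (𝒰.τ_r_γinv ha).symm

/-- A sheet contains one edge over each vertex, so among edges over matching vertices the label
decides: in the sheets over `U i` the conjugacy `γ i` is the identity matrix. -/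
theorem corresponds_iff {i : Fin n} {k l : Fin (m i)} {a : W'} {e : W}
    (ha : a ∈ 𝒰.sheetF i k) (he : e ∈ 𝒰.sheet i l) (h : F.s a = τ (E.s e)) :
    𝒰.Corresponds i a e ↔ k = l := by
  constructor
  · rintro ⟨hs, rfl⟩
    exact 𝒰.sheet_index_unique (𝒰.γinv_mem_sheet ha hs) he
  · rintro rfl
    refine ⟨𝒰.s_mem_of_mem_sheetF ha, 𝒰.eq_of_mem_sheet (𝒰.γinv_mem_sheet ha _) he ?_⟩
    exact τ.injective (by rw [τ_s_γinv, h])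

theorem permE_eq {i j : Fin n} (h : (𝒰.U i ∩ 𝒰.U j).Nonempty) {k : Fin (m i)} {l : Fin (m j)}
    {e : W} (hi : e ∈ 𝒰.sheet i k) (hj : e ∈ 𝒰.sheet j l) : l = 𝒰.permE i j h k :=
  (𝒰.permE_spec i j h k l).mp ⟨e, hi, hj⟩

theorem permF_eq {i j : Fin n} (h : (𝒰.U i ∩ 𝒰.U j).Nonempty) {k : Fin (m i)} {l : Fin (m j)}
    {a : W'} (hi : a ∈ 𝒰.sheetF i k) (hj : a ∈ 𝒰.sheetF j l) : l = 𝒰.permF i j h k :=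
  (𝒰.permF_spec i j h k l).mp ⟨a, hi, hj⟩

theorem mem_sheetF_permF {i j : Fin n} (h : (𝒰.U i ∩ 𝒰.U j).Nonempty) {k : Fin (m i)}
    {a : W'} (hi : a ∈ 𝒰.sheetF i k) (hj : F.s a ∈ 𝒰.baseF j) :
    a ∈ 𝒰.sheetF j (𝒰.permF i j h k) := by
  obtain ⟨l, hl⟩ := 𝒰.exists_mem_sheetF hj
  rwa [← 𝒰.permF_eq h hi hl]

theorem mem_sheet_permE {i j : Fin n} (h : (𝒰.U i ∩ 𝒰.U j).Nonempty) {k : Fin (m i)}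
    {e : W} (hi : e ∈ 𝒰.sheet i k) (hj : E.s e ∈ 𝒰.U j) :
    e ∈ 𝒰.sheet j (𝒰.permE i j h k) := by
  obtain ⟨l, hl⟩ := 𝒰.exists_mem_sheet hj
  rwa [← 𝒰.permE_eq h hi hl]

/-- Passing to the labels over `j` by the overlap permutations shows that `γ j`, read in the labels
over `i`, is the permutation matrix comparing `permF` with `permE`. -/
theorem corresponds_iff_perm {i j : Fin n} (h : (𝒰.U i ∩ 𝒰.U j).Nonempty) {k l : Fin (m i)}
    {a : W'} {e : W} (ha : a ∈ 𝒰.sheetF i k) (he : e ∈ 𝒰.sheet i l) (hs : F.s a = τ (E.s e))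
    (hj : F.s a ∈ 𝒰.baseF j) :
    𝒰.Corresponds j a e ↔ 𝒰.permF i j h k = 𝒰.permE i j h l :=
  𝒰.corresponds_iff (𝒰.mem_sheetF_permF h ha hj)
    (𝒰.mem_sheet_permE h he (𝒰.mem_baseF_iff.mp (hs ▸ hj))) hs

theorem inter_nonempty_of_mem_baseF {i j : Fin n} {v : V'} (hi : v ∈ 𝒰.baseF i)
    (hj : v ∈ 𝒰.baseF j) : (𝒰.U i ∩ 𝒰.U j).Nonempty := by
  obtain ⟨u, hu, rfl⟩ := hi
  exact ⟨u, hu, 𝒰.mem_baseF_iff.mp hj⟩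

theorem γinv_eq_γinv {i j : Fin n} (h : (𝒰.U i ∩ 𝒰.U j).Nonempty) {k : Fin (m i)} {a : W'}
    (ha : a ∈ 𝒰.sheetF i k) (hi : F.s a ∈ 𝒰.baseF i) (hj : F.s a ∈ 𝒰.baseF j)
    (hk : 𝒰.permE i j h k = 𝒰.permF i j h k) : 𝒰.γinv i a hi = 𝒰.γinv j a hj := by
  obtain ⟨_, h'⟩ := (𝒰.corresponds_iff_perm h ha (𝒰.γinv_mem_sheet ha hi) (𝒰.τ_s_γinv hi).symm
    hj).mpr hk.symm
  exact h'.symm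

theorem permE_self (i : Fin n) (h : (𝒰.U i ∩ 𝒰.U i).Nonempty) (k : Fin (m i)) :
    𝒰.permE i i h k = k := by
  obtain ⟨e, he, -⟩ := 𝒰.exists_mem_sheet_over k h.some_mem.1
  exact (𝒰.permE_eq h he he).symm

theorem permF_self (i : Fin n) (h : (𝒰.U i ∩ 𝒰.U i).Nonempty) (k : Fin (m i)) :
    𝒰.permF i i h k = k := by
  obtain ⟨a, ha, -⟩ := 𝒰.exists_mem_sheetF_over k (𝒰.mem_baseF_iff.mpr h.some_mem.1)
  exact (𝒰.permF_eq h ha ha).symm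

theorem exists_mem_baseF (v : V') : ∃ i, v ∈ 𝒰.baseF i := by
  have : τ.symm v ∈ ⋃ i, 𝒰.U i := by rw [𝒰.iUnion_U]; trivial
  obtain ⟨i, hi⟩ := Set.mem_iUnion.mp this
  exact ⟨i, _, hi, by simp⟩

/-- The sheets over `U i` index the fibre over `v`. This turns fibre sums into entries of matrix
products. -/
theorem sum_fiber_E [T2Space V] [CompactSpace W] [T2Space W] {i : Fin n} {v : V}
    (hv : v ∈ 𝒰.U i) {f : W → ℂ} {f' : Fin (m i) → ℂ}
    (hf : ∀ k, ∀ e ∈ 𝒰.sheet i k, E.s e = v → f e = f' k) :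
    ∑ e ∈ (E.finite_fiber v).toFinset, f e = ∑ k, f' k := by
  choose σ hσ hs using fun k => 𝒰.exists_mem_sheet_over k hv
  symm
  refine Finset.sum_bij (fun k _ => σ k) ?_ ?_ ?_ ?_
  · intro k _
    simp [hs]
  · intro k _ l _ h
    have h : σ k = σ l := h
    exact 𝒰.sheet_index_unique (hσ k) (h ▸ hσ l)
  · intro e he
    have he : E.s e = v := by simpa using he
    obtain ⟨k, hk⟩ := 𝒰.exists_mem_sheet (i := i) (by rw [he]; exact hv)
    exact ⟨k, Finset.mem_univ _, 𝒰.eq_of_mem_sheet (hσ k) hk (by rw [hs, he])⟩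
  · intro k _
    exact (hf k _ (hσ k) (hs k)).symm

theorem sum_fiber_F [T2Space V'] [CompactSpace W'] [T2Space W'] {i : Fin n} {v : V'}
    (hv : v ∈ 𝒰.baseF i) {f : W' → ℂ} {f' : Fin (m i) → ℂ}
    (hf : ∀ k, ∀ a ∈ 𝒰.sheetF i k, F.s a = v → f a = f' k) :
    ∑ a ∈ (F.finite_fiber v).toFinset, f a = ∑ k, f' k := by
  choose σ hσ hs using fun k => 𝒰.exists_mem_sheetF_over k hv
  symm
  refine Finset.sum_bij (fun k _ => σ k) ?_ ?_ ?_ ?_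
  · intro k _
    simp [hs]
  · intro k _ l _ h
    have h : σ k = σ l := h
    exact 𝒰.sheetF_index_unique (hσ k) (h ▸ hσ l)
  · intro a ha
    have ha : F.s a = v := by simpa using ha
    obtain ⟨k, hk⟩ := 𝒰.exists_mem_sheetF (i := i) (by rw [ha]; exact hv)
    exact ⟨k, Finset.mem_univ _, 𝒰.eq_of_mem_sheetF (hσ k) hk (by rw [hs, ha])⟩
  · intro k _
    exact (hf k _ (hσ k) (hs k)).symm

/-- A kernel which in the sheets over each `U i` is a continuous family of unitary matrices, and
which intertwines the range maps, induces a unitary equivalence. -/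
theorem exists_unitary_of_local_matrices [CompactSpace V] [T2Space V] [CompactSpace W] [T2Space W]
    [CompactSpace V'] [T2Space V'] [CompactSpace W'] [T2Space W'] (M : W' → W → ℂ)
    (hr : ∀ a e, F.s a = τ (E.s e) → M a e ≠ 0 → F.r a = τ (E.r e))
    (hM : ∀ i, ∃ A : V' → Matrix (Fin (m i)) (Fin (m i)) ℂ,
      (∀ k l, Continuous fun v => A v k l) ∧ (∀ v, (A v).conjTranspose * A v = 1) ∧
      ∀ k l, ∀ a ∈ 𝒰.sheetF i k, ∀ e ∈ 𝒰.sheet i l, F.s a = τ (E.s e) →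
        M a e = A (F.s a) k l) :
    ∃ Γ : CorrespondenceUnitary (τ.symm.compStarAlgEquiv' ℂ ℂ) E.Correspondence F.Correspondence,
      ∀ x a, Γ.toLinearEquiv x a =
        ∑ e ∈ (E.finite_fiber (τ.symm (F.s a))).toFinset, M a e * x e := by
  classical
  choose A hAc hAu hA using hM
  refine E.exists_unitary_of_kernel F τ M ?_ hr ?_ ?_
  · rintro ⟨a, e⟩ hae
    have hae : F.s a = τ (E.s e) := hae
    obtain ⟨i, hi⟩ := 𝒰.exists_mem_baseF (F.s a)
    obtain ⟨k, hk⟩ := 𝒰.exists_mem_sheetF hi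
    obtain ⟨l, hl⟩ := 𝒰.exists_mem_sheet (𝒰.mem_baseF_iff.mp (hae ▸ hi))
    have hc : Continuous fun p : W' × W => A i (F.s p.1) k l :=
      (hAc i k l).comp (F.isLocalHomeomorph_s.continuous.comp continuous_fst)
    refine hc.continuousWithinAt.congr_of_eventuallyEq ?_ (hA i k l a hk e hl hae)
    -- The labels `k`, `l` are constant on this neighbourhood, so there the kernel is a single
    -- matrix entry.
    have hn : 𝒰.sheetF i k ×ˢ 𝒰.sheet i l ∈ nhds (a, e) :=
      ((𝒰.isOpen_sheetF i k).prod (𝒰.isOpen_sheet i l)).mem_nhds ⟨hk, hl⟩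
    filter_upwards [mem_nhdsWithin_of_mem_nhds hn, self_mem_nhdsWithin] with p hp hp'
    exact hA i k l _ hp.1 _ hp.2 hp'
  · intro e e' hee
    obtain ⟨i, hi⟩ := 𝒰.exists_mem_baseF (τ (E.s e))
    have hU := 𝒰.mem_baseF_iff.mp hi
    obtain ⟨l, hl⟩ := 𝒰.exists_mem_sheet hU
    obtain ⟨l', hl'⟩ := 𝒰.exists_mem_sheet (hee ▸ hU)
    have h := congrFun (congrFun (hAu i (τ (E.s e))) l) l'
    rw [Matrix.mul_apply, Matrix.one_apply] at h
    have hiff : l = l' ↔ e = e' :=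
      ⟨fun h => 𝒰.eq_of_mem_sheet hl (h ▸ hl') hee, fun h => 𝒰.sheet_index_unique hl (h ▸ hl')⟩
    simp only [hiff] at h
    rw [← h]
    refine 𝒰.sum_fiber_F hi fun k a ha hs => ?_
    rw [hA i k l a ha e hl hs, hA i k l' a ha e' hl' (hee ▸ hs), hs]
    rfl
  · intro a a' haa
    obtain ⟨i, hi⟩ := 𝒰.exists_mem_baseF (F.s a)
    obtain ⟨k, hk⟩ := 𝒰.exists_mem_sheetF hi
    obtain ⟨k', hk'⟩ := 𝒰.exists_mem_sheetF (haa ▸ hi)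
    -- For square matrices a left inverse is a right inverse, so the isometry condition already
    -- gives the coisometry condition.
    have hAu' : A i (F.s a) * (A i (F.s a)).conjTranspose = 1 := mul_eq_one_comm.mp (hAu i _)
    have h := congrFun (congrFun hAu' k) k'
    rw [Matrix.mul_apply, Matrix.one_apply] at h
    have hiff : k = k' ↔ a = a' :=
      ⟨fun h => 𝒰.eq_of_mem_sheetF hk (h ▸ hk') haa, fun h => 𝒰.sheetF_index_unique hk (h ▸ hk')⟩
    simp only [hiff] at h
    rw [← h]
    refine 𝒰.sum_fiber_E (𝒰.mem_baseF_iff.mp (by simpa using hi)) fun l e he hs => ?_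
    have hs : F.s a = τ (E.s e) := by simp [hs]
    rw [hA i k l a hk e he hs, hA i k' l a' hk' e he (haa ▸ hs), haa]
    rfl

end AdmissibleCover

/-! ### The interpolating function and the rotation kernel -/

namespace AdmissibleCover

variable {V W V' W' : Type*} [TopologicalSpace V] [TopologicalSpace W]
  [TopologicalSpace V'] [TopologicalSpace W'] {E : TopologicalGraph V W}
  {F : TopologicalGraph V' W'} {τ : V ≃ₜ V'} {n : ℕ} {m : Fin n → ℕ}
  (𝒰 : AdmissibleCover E F τ n m)

/-- Urysohn's lemma, scaled by `π/2`, for the two closed sets that (C4) makes disjoint. -/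
theorem exists_interpolation [CompactSpace V'] [T2Space V'] {i j : Fin n} (hij : i ≠ j) :
    ∃ g : C(V', ℝ), (∀ v, g v ∈ Set.Icc 0 (Real.pi / 2)) ∧
      (∀ v ∈ closure (𝒰.baseF i) \ 𝒰.baseF j, g v = 0) ∧
      (∀ v ∈ closure (𝒰.baseF j) \ 𝒰.baseF i, g v = Real.pi / 2) := by
  have hcl : ∀ i j, IsClosed (closure (𝒰.baseF i) \ 𝒰.baseF j) := fun i j =>
    isClosed_closure.sdiff (𝒰.isOpen_baseF j)
  have himage : ∀ i j, closure (𝒰.baseF i) \ 𝒰.baseF j = τ '' (closure (𝒰.U i) \ 𝒰.U j) := by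
    intro i j
    rw [Set.image_sdiff τ.injective, τ.image_closure]
    rfl
  have hd : Disjoint (closure (𝒰.baseF i) \ 𝒰.baseF j) (closure (𝒰.baseF j) \ 𝒰.baseF i) := by
    rw [himage, himage]
    exact (Set.disjoint_image_iff τ.injective).mpr (𝒰.disjoint_diff i j hij)
  obtain ⟨f, hf₀, hf₁, hf⟩ := exists_continuous_zero_one_of_isClosed (hcl i j) (hcl j i) hd
  refine ⟨⟨fun v => Real.pi / 2 * f v, by fun_prop⟩, fun v => ?_, fun v hv => ?_, fun v hv => ?_⟩
  · have hpi := Real.pi_pos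
    constructor
    · exact mul_nonneg (by positivity) (hf v).1
    · exact mul_le_of_le_one_right (by positivity) (hf v).2
  · simp [hf₀ hv]
  · simp [hf₁ hv]

open Classical in
/-- The kernel that equals the conjugacies outside two sets `P` and `Q` of edges, and there
rotates from the conjugacy `γ i` to the conjugacy `γ j` with angle `g`. -/
noncomputable def rotationKernel (i j : Fin n) (P Q : Set W') (g : V' → ℝ) (a : W') (e : W) : ℂ :=
  if a ∈ P then
    Real.cos (g (F.s a)) * (if 𝒰.Corresponds i a e then 1 else 0) +
      Real.sin (g (F.s a)) * (if 𝒰.Corresponds j a e then 1 else 0)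
  else if a ∈ Q then
    Complex.exp (2 * Complex.I * g (F.s a)) *
      (Real.cos (g (F.s a)) * (if 𝒰.Corresponds i a e then 1 else 0) -
        Real.sin (g (F.s a)) * (if 𝒰.Corresponds j a e then 1 else 0))
  else if ∃ i', 𝒰.Corresponds i' a e then 1 else 0

/-- Every term of the kernel contains the indicator of some conjugacy, and each conjugacy
intertwines the range maps. -/
theorem r_eq_of_rotationKernel_ne_zero {i j : Fin n} {P Q : Set W'} {g : V' → ℝ} {a : W'} {e : W}
    (h : 𝒰.rotationKernel i j P Q g a e ≠ 0) : F.r a = τ (E.r e) := by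
  by_contra hr
  have hc : ∀ i', ¬ 𝒰.Corresponds i' a e := fun i' hi' => hr hi'.r_eq
  exact h (by simp [rotationKernel, hc])

/-- Evaluates the indicator of `γ i` as a kernel. The predicate `p` is kept free so that the
existential branch of `rotationKernel` is covered too. -/
theorem sum_corresponds [T2Space V] [CompactSpace W] [T2Space W] {i : Fin n} {a : W'}
    (ha : F.s a ∈ 𝒰.baseF i) (p : W → Prop) [DecidablePred p]
    (hp : ∀ e, p e ↔ 𝒰.Corresponds i a e) (x : W → ℂ) :
    ∑ e ∈ (E.finite_fiber (τ.symm (F.s a))).toFinset, (if p e then 1 else 0) * x e =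
      x (𝒰.γinv i a ha) := by
  rw [Finset.sum_eq_single (𝒰.γinv i a ha)]
  · simp [(hp _).mpr ⟨ha, rfl⟩]
  · intro e _ hne
    rw [if_neg, zero_mul]
    rw [hp]
    rintro ⟨_, rfl⟩
    exact hne rfl
  · intro h
    refine absurd ?_ h
    simp [← 𝒰.τ_s_γinv ha]

/-! ### Overlap permutations that differ by one transposition -/

section Flip

variable {m : ℕ} (𝒰 : AdmissibleCover E F τ n (fun _ => m)) {i₀ j₀ : Fin n}
  (h₀ : (𝒰.U i₀ ∩ 𝒰.U j₀).Nonempty) {k₀ l₀ : Fin m}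

/-- For equal indices both overlap permutations are the identity, which leaves no room for a
transposition. -/
theorem ne_of_flip (hkl : k₀ ≠ l₀)
    (hflip : 𝒰.permE i₀ j₀ h₀ = (Equiv.swap k₀ l₀).trans (𝒰.permF i₀ j₀ h₀)) : i₀ ≠ j₀ := by
  rintro rfl
  have h := congrFun (congrArg DFunLike.coe hflip) k₀
  rw [Equiv.trans_apply, 𝒰.permE_self, 𝒰.permF_self, Equiv.swap_apply_left] at h
  exact hkl h

/-- The edges over `baseF i₀ ∩ baseF j₀` in the sheet `k`. -/
def overlapSheet (k : Fin m) : Set W' :=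
  𝒰.sheetF i₀ k ∩ 𝒰.sheetF j₀ (𝒰.permF i₀ j₀ h₀ k)

variable {h₀} in
-- The overlap permutations of `E` and `F` take the same value at every label except `k₀`, `l₀` over
-- the exceptional pair. Hence the value `x(γ_i⁻¹(a))` in the formula for `Γ` does not depend on
-- `i`.
theorem γinv_eq_of_notMem_overlap
    (hagree : ∀ i j (h : (𝒰.U i ∩ 𝒰.U j).Nonempty), s(i, j) ≠ s(i₀, j₀) →
      𝒰.permE i j h = 𝒰.permF i j h)
    (hflip : 𝒰.permE i₀ j₀ h₀ = (Equiv.swap k₀ l₀).trans (𝒰.permF i₀ j₀ h₀)) {a : W'}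
    (hP : a ∉ 𝒰.overlapSheet h₀ k₀) (hQ : a ∉ 𝒰.overlapSheet h₀ l₀) {i j : Fin n}
    (hi : F.s a ∈ 𝒰.baseF i) (hj : F.s a ∈ 𝒰.baseF j) : 𝒰.γinv i a hi = 𝒰.γinv j a hj := by
  have hflipped : ∀ (hi : F.s a ∈ 𝒰.baseF i₀) (hj : F.s a ∈ 𝒰.baseF j₀),
      𝒰.γinv i₀ a hi = 𝒰.γinv j₀ a hj := by
    intro hi hj
    obtain ⟨k, hk⟩ := 𝒰.exists_mem_sheetF hi
    have hk' := 𝒰.mem_sheetF_permF h₀ hk hj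
    refine 𝒰.γinv_eq_γinv h₀ hk hi hj ?_
    rw [hflip, Equiv.trans_apply, Equiv.swap_apply_of_ne_of_ne]
    · rintro rfl
      exact hP ⟨hk, hk'⟩
    · rintro rfl
      exact hQ ⟨hk, hk'⟩
  by_cases hs : s(i, j) = s(i₀, j₀)
  · rcases Sym2.eq_iff.mp hs with ⟨rfl, rfl⟩ | ⟨rfl, rfl⟩
    · exact hflipped hi hj
    · exact (hflipped hj hi).symm
  · obtain ⟨k, hk⟩ := 𝒰.exists_mem_sheetF hi
    have h := 𝒰.inter_nonempty_of_mem_baseF hi hj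
    exact 𝒰.γinv_eq_γinv h hk hi hj (by rw [hagree i j h hs])

variable {h₀} in
theorem exists_corresponds_iff
    (hagree : ∀ i j (h : (𝒰.U i ∩ 𝒰.U j).Nonempty), s(i, j) ≠ s(i₀, j₀) →
      𝒰.permE i j h = 𝒰.permF i j h)
    (hflip : 𝒰.permE i₀ j₀ h₀ = (Equiv.swap k₀ l₀).trans (𝒰.permF i₀ j₀ h₀)) {a : W'}
    (hP : a ∉ 𝒰.overlapSheet h₀ k₀) (hQ : a ∉ 𝒰.overlapSheet h₀ l₀) {i : Fin n}
    (hi : F.s a ∈ 𝒰.baseF i) (e : W) : (∃ j, 𝒰.Corresponds j a e) ↔ 𝒰.Corresponds i a e := by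
  refine ⟨?_, fun h => ⟨i, h⟩⟩
  rintro ⟨j, hj, rfl⟩
  exact ⟨hi, 𝒰.γinv_eq_of_notMem_overlap hagree hflip hP hQ hi hj⟩

theorem mem_overlapSheet_iff {k k' : Fin m} {a : W'} (hk : a ∈ 𝒰.sheetF i₀ k)
    (hj : F.s a ∈ 𝒰.baseF j₀) : a ∈ 𝒰.overlapSheet h₀ k' ↔ k = k' := by
  refine ⟨fun h => 𝒰.sheetF_index_unique hk h.1, ?_⟩
  rintro rfl
  exact ⟨hk, 𝒰.mem_sheetF_permF h₀ hk hj⟩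

theorem s_mem_of_mem_overlapSheet {k : Fin m} {a : W'} (ha : a ∈ 𝒰.overlapSheet h₀ k) :
    F.s a ∈ 𝒰.baseF i₀ ∧ F.s a ∈ 𝒰.baseF j₀ :=
  ⟨𝒰.s_mem_of_mem_sheetF ha.1, 𝒰.s_mem_of_mem_sheetF ha.2⟩

open Classical in
variable {h₀} in
/-- The rotation kernel over `baseF i₀ ∩ baseF j₀` in terms of the sheets over `U i₀`. -/
theorem rotationKernel_of_mem_overlap (hkl : k₀ ≠ l₀)
    (hagree : ∀ i j (h : (𝒰.U i ∩ 𝒰.U j).Nonempty), s(i, j) ≠ s(i₀, j₀) →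
      𝒰.permE i j h = 𝒰.permF i j h)
    (hflip : 𝒰.permE i₀ j₀ h₀ = (Equiv.swap k₀ l₀).trans (𝒰.permF i₀ j₀ h₀)) (g : V' → ℝ)
    {k l : Fin m} {a : W'} {e : W} (ha : a ∈ 𝒰.sheetF i₀ k) (he : e ∈ 𝒰.sheet i₀ l)
    (hs : F.s a = τ (E.s e)) (hj : F.s a ∈ 𝒰.baseF j₀) :
    𝒰.rotationKernel i₀ j₀ (𝒰.overlapSheet h₀ k₀) (𝒰.overlapSheet h₀ l₀) g a e =
      twoBlock k₀ l₀ (Real.cos (g (F.s a))) (Real.sin (g (F.s a)))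
        (-(Complex.exp (2 * Complex.I * g (F.s a)) * Real.sin (g (F.s a))))
        (Complex.exp (2 * Complex.I * g (F.s a)) * Real.cos (g (F.s a))) k l := by
  have hi := 𝒰.s_mem_of_mem_sheetF ha
  have hci : 𝒰.Corresponds i₀ a e ↔ k = l := 𝒰.corresponds_iff ha he hs
  -- In the labels over `i₀`, the conjugacy `γ j₀` is the transposition. On the rows `k₀` and `l₀`
  -- the kernel combines it with the identity.
  have hcj : 𝒰.Corresponds j₀ a e ↔ k = Equiv.swap k₀ l₀ l := by
    rw [𝒰.corresponds_iff_perm h₀ ha he hs hj, hflip, Equiv.trans_apply,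
      EmbeddingLike.apply_eq_iff_eq]
  have hP := 𝒰.mem_overlapSheet_iff h₀ (k' := k₀) ha hj
  have hQ := 𝒰.mem_overlapSheet_iff h₀ (k' := l₀) ha hj
  unfold rotationKernel twoBlock
  by_cases hk₀ : k = k₀
  · subst hk₀
    rcases eq_or_ne l k with rfl | hl
    · simp [hP, hci, hcj, hkl]
    · rcases eq_or_ne l l₀ with rfl | hl'
      · simp [hP, hci, hcj, hkl, hkl.symm]
      · simp [hP, hci, hcj, hl, hl.symm, hl', Equiv.swap_apply_of_ne_of_ne]
  · by_cases hl₀ : k = l₀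
    · subst hl₀
      rcases eq_or_ne l k with rfl | hl
      · simp [hP, hQ, hci, hcj, hk₀]
      · rcases eq_or_ne l k₀ with rfl | hl'
        · simp [hP, hQ, hci, hcj, hkl.symm]
        · simp [hP, hQ, hci, hcj, hk₀, hl, hl.symm, hl', Equiv.swap_apply_of_ne_of_ne]
    · simp only [hP, hQ, hk₀, hl₀, if_false]
      simp only [𝒰.exists_corresponds_iff hagree hflip (mt hP.mp hk₀) (mt hQ.mp hl₀) hi, hci]
      congr

variable {h₀} in
/-- In the sheets over each `U i`, the rotation kernel is a continuous unitary matrix. -/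
theorem exists_matrix_rotationKernel (hkl : k₀ ≠ l₀)
    (hagree : ∀ i j (h : (𝒰.U i ∩ 𝒰.U j).Nonempty), s(i, j) ≠ s(i₀, j₀) →
      𝒰.permE i j h = 𝒰.permF i j h)
    (hflip : 𝒰.permE i₀ j₀ h₀ = (Equiv.swap k₀ l₀).trans (𝒰.permF i₀ j₀ h₀)) (g : C(V', ℝ))
    (hg₀ : ∀ v ∈ closure (𝒰.baseF i₀) \ 𝒰.baseF j₀, g v = 0)
    (hg₁ : ∀ v ∈ closure (𝒰.baseF j₀) \ 𝒰.baseF i₀, g v = Real.pi / 2) (i : Fin n) :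
    ∃ A : V' → Matrix (Fin m) (Fin m) ℂ,
      (∀ k l, Continuous fun v => A v k l) ∧ (∀ v, (A v).conjTranspose * A v = 1) ∧
      ∀ k l, ∀ a ∈ 𝒰.sheetF i k, ∀ e ∈ 𝒰.sheet i l, F.s a = τ (E.s e) →
        𝒰.rotationKernel i₀ j₀ (𝒰.overlapSheet h₀ k₀) (𝒰.overlapSheet h₀ l₀) g a e =
          A (F.s a) k l := by
  classical
  have hij := 𝒰.ne_of_flip h₀ hkl hflip
  have hexp : ∀ t : ℝ, star (Complex.exp (2 * Complex.I * t)) * Complex.exp (2 * Complex.I * t) =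
      1 := by
    intro t
    rw [Complex.star_def, ← Complex.exp_conj, ← Complex.exp_add, map_mul, map_mul,
      Complex.conj_I, Complex.conj_ofReal, map_ofNat]
    simp
  have hcs : ∀ t : ℝ, (Real.cos t : ℂ) * Real.cos t + Real.sin t * Real.sin t = 1 := by
    intro t
    have := Real.cos_sq_add_sin_sq t
    rw [← Complex.ofReal_mul, ← Complex.ofReal_mul, ← Complex.ofReal_add, ← sq, ← sq, this,
      Complex.ofReal_one]
  have hstar : ∀ t : ℝ, star (t : ℂ) = t := Complex.conj_ofReal
  -- Off the overlap of `i₀` and `j₀` the kernel is the plain conjugacy, that is, the identity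
  -- matrix.
  have hout : ∀ {a : W'} {k l : Fin m} {e : W},
      ¬ (F.s a ∈ 𝒰.baseF i₀ ∧ F.s a ∈ 𝒰.baseF j₀) → a ∈ 𝒰.sheetF i k → e ∈ 𝒰.sheet i l →
      F.s a = τ (E.s e) →
      𝒰.rotationKernel i₀ j₀ (𝒰.overlapSheet h₀ k₀) (𝒰.overlapSheet h₀ l₀) g a e =
        if k = l then 1 else 0 := by
    intro a k l e hn ha he hs
    have hP : a ∉ 𝒰.overlapSheet h₀ k₀ := fun h => hn (𝒰.s_mem_of_mem_overlapSheet h₀ h)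
    have hQ : a ∉ 𝒰.overlapSheet h₀ l₀ := fun h => hn (𝒰.s_mem_of_mem_overlapSheet h₀ h)
    simp only [rotationKernel, hP, hQ, if_false, 𝒰.corresponds_iff ha he hs,
      𝒰.exists_corresponds_iff hagree hflip hP hQ (𝒰.s_mem_of_mem_sheetF ha)]
  by_cases hi : i = i₀
  · subst hi
    -- The rotation formula is used on all of `V'`, which makes continuity immediate. Over `U i₀`
    -- off the overlap `g = 0` reduces it to the identity, as `hout` requires.
    refine ⟨fun v => twoBlock k₀ l₀ (Real.cos (g v)) (Real.sin (g v))
      (-(Complex.exp (2 * Complex.I * g v) * Real.sin (g v)))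
      (Complex.exp (2 * Complex.I * g v) * Real.cos (g v)), ?_, ?_, ?_⟩
    · intro k l
      exact continuous_twoBlock_apply _ _ _ _ (by fun_prop) (by fun_prop) (by fun_prop)
        (by fun_prop)
    · intro v
      refine twoBlock_conjTranspose_mul_self hkl ?_ ?_ ?_
      · simp only [star_mul', star_neg, hstar]
        linear_combination hcs (g v) + (Real.sin (g v) : ℂ) ^ 2 * hexp (g v)
      · simp only [star_mul', hstar]
        linear_combination hcs (g v) + (Real.cos (g v) : ℂ) ^ 2 * hexp (g v)
      · simp only [star_mul', star_neg, hstar]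
        linear_combination -(Real.cos (g v) : ℂ) * Real.sin (g v) * hexp (g v)
    · intro k l a ha e he hs
      beta_reduce
      by_cases hj : F.s a ∈ 𝒰.baseF j₀
      · exact 𝒰.rotationKernel_of_mem_overlap hkl hagree hflip g ha he hs hj
      · rw [hout (fun h => hj h.2) ha he hs,
          hg₀ _ ⟨subset_closure (𝒰.s_mem_of_mem_sheetF ha), hj⟩]
        simpa using (twoBlock_identity k₀ l₀ k l).symm
  by_cases hj : i = j₀
  · subst hj
    set π := 𝒰.permF i₀ i h₀ with hπ
    -- The same matrix in the labels over `j₀`: `π` relabels rows and columns, and the columns `k₀`,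
    -- `l₀` are interchanged because it is now `γ j₀` that must be the identity. At `g = π/2` the
    -- block is the identity, since the phase is `-1`.
    refine ⟨fun v => (twoBlock k₀ l₀ (Real.sin (g v)) (Real.cos (g v))
      (Complex.exp (2 * Complex.I * g v) * Real.cos (g v))
      (-(Complex.exp (2 * Complex.I * g v) * Real.sin (g v)))).submatrix π.symm π.symm, ?_, ?_, ?_⟩
    · intro k l
      exact continuous_twoBlock_apply _ _ _ _ (by fun_prop) (by fun_prop) (by fun_prop)
        (by fun_prop)
    · intro v
      have h := twoBlock_conjTranspose_mul_self (ι := Fin m) hkl (α := Real.sin (g v))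
        (β := Real.cos (g v)) (γ := Complex.exp (2 * Complex.I * g v) * Real.cos (g v))
        (δ := -(Complex.exp (2 * Complex.I * g v) * Real.sin (g v))) ?_ ?_ ?_
      · have h' := congrArg (fun B : Matrix (Fin m) (Fin m) ℂ => B.submatrix π.symm π.symm) h
        rw [Matrix.submatrix_one_equiv, ← Matrix.submatrix_mul_equiv _ _ _ π.symm] at h'
        exact h'
      · simp only [star_mul', hstar]
        linear_combination hcs (g v) + (Real.cos (g v) : ℂ) ^ 2 * hexp (g v)
      · simp only [star_mul', star_neg, hstar]
        linear_combination hcs (g v) + (Real.sin (g v) : ℂ) ^ 2 * hexp (g v)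
      · simp only [star_mul', hstar]
        linear_combination -(Real.cos (g v) : ℂ) * Real.sin (g v) * hexp (g v)
    · intro k l a ha e he hs
      beta_reduce
      by_cases hi' : F.s a ∈ 𝒰.baseF i₀
      · obtain ⟨k', hk'⟩ := 𝒰.exists_mem_sheetF hi'
        obtain ⟨l', hl'⟩ := 𝒰.exists_mem_sheet (𝒰.mem_baseF_iff.mp (hs ▸ hi'))
        have hk : π.symm k = k' := by rw [Equiv.symm_apply_eq]; exact 𝒰.permF_eq h₀ hk' ha
        -- Edges of `E` change labels by `permE`, which is `π` after the transposition; edges of `F`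
        -- change by `π` alone.
        have hl : π.symm l = Equiv.swap k₀ l₀ l' := by
          rw [Equiv.symm_apply_eq, 𝒰.permE_eq h₀ hl' he, hflip]
          rfl
        rw [𝒰.rotationKernel_of_mem_overlap hkl hagree hflip g hk' hl' hs
          (𝒰.s_mem_of_mem_sheetF ha), Matrix.submatrix_apply, hk, hl]
        unfold twoBlock
        rcases eq_or_ne l' k₀ with rfl | h₁
        · simp [hkl.symm]
          grind
        · rcases eq_or_ne l' l₀ with rfl | h₂
          · simp [hkl.symm]
            grind
          · rw [Equiv.swap_apply_of_ne_of_ne h₁ h₂]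
            simp [h₁, h₂]
      · rw [hout (fun h => hi' h.1) ha he hs,
          hg₁ _ ⟨subset_closure (𝒰.s_mem_of_mem_sheetF ha), hi'⟩]
        have hexp' : Complex.exp (2 * Complex.I * (Real.pi / 2 : ℝ)) = -1 := by
          rw [← Complex.exp_pi_mul_I]
          congr 1
          push_cast
          ring
        have := twoBlock_identity k₀ l₀ (π.symm k) (π.symm l)
        simp only [EmbeddingLike.apply_eq_iff_eq] at this
        rw [← this, hexp', Matrix.submatrix_apply]
        simp
  -- By (C3) a third set of the cover misses the overlap of `i₀` and `j₀`, so `hout` applies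
  -- everywhere over it.
  · refine ⟨fun _ => 1, fun _ _ => continuous_const, fun _ => by simp, ?_⟩
    intro k l a ha e he hs
    beta_reduce
    rw [Matrix.one_apply]
    refine hout ?_ ha he hs
    rintro ⟨⟨u, hu, huv⟩, hv⟩
    rw [← huv, 𝒰.mem_baseF_iff] at hv
    have hv' := 𝒰.s_mem_of_mem_sheetF ha
    rw [← huv, 𝒰.mem_baseF_iff] at hv'
    have := 𝒰.inter_eq_empty i₀ j₀ i hij (Ne.symm hj) hi
    exact Set.eq_empty_iff_forall_notMem.mp this u ⟨⟨hu, hv⟩, hv'⟩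

end Flip

end AdmissibleCover

/-! ### The unitary and its explicit formula -/

theorem lemmaL {V W V' W' : Type*}
    [TopologicalSpace V] [CompactSpace V] [T2Space V]
    [TopologicalSpace W] [CompactSpace W] [T2Space W]
    [TopologicalSpace V'] [CompactSpace V'] [T2Space V']
    [TopologicalSpace W'] [CompactSpace W'] [T2Space W']
    (E : TopologicalGraph V W) (F : TopologicalGraph V' W') (τ : V ≃ₜ V')
    (hconj : LocallyConjugateVia E F τ) (hdim : CoveringDimLE V 1)
    (n m : ℕ) (𝒰 : AdmissibleCover E F τ n (fun _ => m))
    (i₀ j₀ : Fin n) (h₀ : (𝒰.U i₀ ∩ 𝒰.U j₀).Nonempty)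
    (k₀ l₀ : Fin m) (hkl : k₀ ≠ l₀)
    (hagree : ∀ i j (h : (𝒰.U i ∩ 𝒰.U j).Nonempty), s(i, j) ≠ s(i₀, j₀) →
      𝒰.permE i j h = 𝒰.permF i j h)
    (hflip : 𝒰.permE i₀ j₀ h₀ = (Equiv.swap k₀ l₀).trans (𝒰.permF i₀ j₀ h₀)) :
    ∃ Γ : CorrespondenceUnitary (τ.symm.compStarAlgEquiv' ℂ ℂ) E.Correspondence F.Correspondence,
    ∃ g : C(V', ℝ), (∀ v, g v ∈ Set.Icc 0 (Real.pi / 2)) ∧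
      (∀ v ∈ closure (𝒰.baseF i₀) \ 𝒰.baseF j₀, g v = 0) ∧
      (∀ v ∈ closure (𝒰.baseF j₀) \ 𝒰.baseF i₀, g v = Real.pi / 2) ∧
      ∀ (x : E.Correspondence) (a : W'),
        (∀ i (ha : F.s a ∈ 𝒰.baseF i),
          a ∉ 𝒰.sheetF i₀ k₀ ∩ 𝒰.sheetF j₀ (𝒰.permF i₀ j₀ h₀ k₀) →
          a ∉ 𝒰.sheetF i₀ l₀ ∩ 𝒰.sheetF j₀ (𝒰.permF i₀ j₀ h₀ l₀) →
          Γ.toLinearEquiv x a = x (𝒰.γinv i a ha)) ∧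
        (∀ (hi : F.s a ∈ 𝒰.baseF i₀) (hj : F.s a ∈ 𝒰.baseF j₀),
          (a ∈ 𝒰.sheetF i₀ k₀ ∩ 𝒰.sheetF j₀ (𝒰.permF i₀ j₀ h₀ k₀) →
            Γ.toLinearEquiv x a =
              Real.cos (g (F.s a)) * x (𝒰.γinv i₀ a hi) +
                Real.sin (g (F.s a)) * x (𝒰.γinv j₀ a hj)) ∧
          (a ∈ 𝒰.sheetF i₀ l₀ ∩ 𝒰.sheetF j₀ (𝒰.permF i₀ j₀ h₀ l₀) →
            Γ.toLinearEquiv x a =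
              Complex.exp (2 * Complex.I * g (F.s a)) *
                (Real.cos (g (F.s a)) * x (𝒰.γinv i₀ a hi) -
                  Real.sin (g (F.s a)) * x (𝒰.γinv j₀ a hj)))) := by
  classical
  have hij := 𝒰.ne_of_flip h₀ hkl hflip
  obtain ⟨g, hg, hg₀, hg₁⟩ := 𝒰.exists_interpolation hij
  obtain ⟨Γ, hΓ⟩ := 𝒰.exists_unitary_of_local_matrices _
    (fun _ _ _ => 𝒰.r_eq_of_rotationKernel_ne_zero)
    (𝒰.exists_matrix_rotationKernel hkl hagree hflip g hg₀ hg₁)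
  refine ⟨Γ, g, hg, hg₀, hg₁, fun x a => ⟨fun i ha hP hQ => ?_, fun hi hj => ⟨fun hP => ?_,
    fun hQ => ?_⟩⟩⟩
  · rw [hΓ, ← 𝒰.sum_corresponds ha (fun e => ∃ j, 𝒰.Corresponds j a e)
      (𝒰.exists_corresponds_iff hagree hflip hP hQ ha) x]
    refine Finset.sum_congr rfl fun e _ => ?_
    rw [AdmissibleCover.rotationKernel, if_neg (show a ∉ 𝒰.overlapSheet h₀ k₀ from hP),
      if_neg (show a ∉ 𝒰.overlapSheet h₀ l₀ from hQ)]
  · rw [hΓ, ← 𝒰.sum_corresponds hi _ (fun _ => Iff.rfl) x,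
      ← 𝒰.sum_corresponds hj _ (fun _ => Iff.rfl) x, Finset.mul_sum, Finset.mul_sum,
      ← Finset.sum_add_distrib]
    refine Finset.sum_congr rfl fun e _ => ?_
    rw [AdmissibleCover.rotationKernel, if_pos (show a ∈ 𝒰.overlapSheet h₀ k₀ from hP)]
    ring
  -- `P` and `Q` lie in different sheets over `i₀`, so on `Q` the first branch of the kernel is
  -- skipped.
  · have hP : a ∉ 𝒰.overlapSheet h₀ k₀ := fun hP => hkl (𝒰.sheetF_index_unique hP.1 hQ.1)
    rw [hΓ, ← 𝒰.sum_corresponds hi _ (fun _ => Iff.rfl) x,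
      ← 𝒰.sum_corresponds hj _ (fun _ => Iff.rfl) x, Finset.mul_sum, Finset.mul_sum,
      ← Finset.sum_sub_distrib, Finset.mul_sum]
    refine Finset.sum_congr rfl fun e _ => ?_
    rw [AdmissibleCover.rotationKernel, if_neg hP,
      if_pos (show a ∈ 𝒰.overlapSheet h₀ l₀ from hQ)]
    ring
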